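/- For a directed graph $G$, let $\Delta(G)$ be the simplicial complex whose vertices are the edges of $G$ and whose simplices are the sets of edges of $G$ that form a directed forest (every vertex is the head of at most one of the edges, and there is no directed cycle). For an integer $t\ge 0$ let $L_t$ be the double directed string on the vertices $1,\dots,t+1$, with edges $i\to i+1$ and $i+1\to i$ for $1\le i\le t$. Let $L'_t$ be the directed graph on $1,\dots,t+2$ whose edges are all $x\to y$ with $|x-y|=1$ and $y\notin\{1,t+2\}$; thus for $t\ge1$ its edges are $1\to2$, $t+2\to t+1$, and $i\to i+1$, $i+1\to i$ for $2\le i\le t$, while $L'_0$ has no edges. For a partition $\lambda$ of $n\ge 1$ let $D_\lambda$ be the set of all compositions of $n$ that are refined by some composition whose multiset of parts is $\lambda$, ordered by refinement (coarser compositions being smaller), and let $\delta_\lambda$ be the simplicial complex with face poset $D_\lambda$: identifying a composition $[\alpha_1,\dots,\alpha_l]$ with its set of proper partial sums $\{\alpha_1+\dots+\alpha_j : 1\le j<l\}\subseteq\{1,\dots,n-1\}$, the simplices of $\delta_\lambda$ are the subsets of $\{1,\dots,n-1\}$ so obtained from $D_\lambda$. (For $\lambda=(3,1^t)$, $n=t+3$,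 these are the sets $\sigma\subseteq\{1,\dots,t+2\}$ such that $i,i+1\notin\sigma$ for some $1\le i\le t+1$.) **Theorem.** Let $t\ge 0$. The bijection of edges $(i+1\to i)\mapsto(i\to i+1)$, $(i\to i+1)\mapsto(i+2\to i+1)$, $1\le i\le t$, is an isomorphism of simplicial complexes $\Delta(L_t)\cong\Delta(L'_t)$. The assignment $(x\to y)\mapsto x$ defines a simplicial map $\phi:\Delta(L'_t)\to\delta_{(3,1^t)}$. The continuous map of geometric realizations induced by $\phi$ is a homotopy equivalence, and so is its composition with the above isomorphism, $\Delta(L_t)\cong\Delta(L'_t)\to\delta_{(3,1^t)}$. -/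

import Mathlib

namespace ForestComplex

/-! ### Finite simplicial complexes and their geometric realizations

`PreAbstractSimplicialComplex ι` is Mathlib's notion of a simplicial complex whose set of vertices is
a subset of `ι`; its faces are the nonempty simplices. -/

section Realization

variable {α β γ : Type*}

/-- The vertices of a simplicial complex. -/
def vertices (K : PreAbstractSimplicialComplex α) : Set α :=
  {a | {a} ∈ K}

/-- A map of vertices is simplicial if it maps every simplex of `K` onto a simplex of `L`.
(Its values outside of the vertices of `K` are irrelevant.) -/
def IsSimplicialMap [DecidableEq β] (K : PreAbstractSimplicialComplex α)
    (L : PreAbstractSimplicialComplex β) (f : α → β) : Prop :=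
  ∀ s ∈ K, s.image f ∈ L

/-- A map of vertices is an isomorphism of simplicial complexes if it is a bijection between the
vertices, under which the simplices of `K` and of `L` correspond to each other. -/
structure IsSimplicialIso [DecidableEq β] (K : PreAbstractSimplicialComplex α)
    (L : PreAbstractSimplicialComplex β) (f : α → β) : Prop where
  bijOn : Set.BijOn f (vertices K) (vertices L)
  image_mem_iff : ∀ s : Finset α, (s : Set α) ⊆ vertices K → (s.image f ∈ L ↔ s ∈ K)

lemma IsSimplicialIso.isSimplicialMap [DecidableEq β] {K : PreAbstractSimplicialComplex α}
    {L : PreAbstractSimplicialComplex β} {f : α → β} (hf : IsSimplicialIso K L f) :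
    IsSimplicialMap K L f := fun s hs =>
  (hf.image_mem_iff s fun _ ha => (K.isRelLowerSet_faces hs).2
    (Finset.singleton_subset_iff.2 ha) (Finset.singleton_nonempty _)).2 hs

/-- The support of a point given by its barycentric coordinates. -/
noncomputable def support [Fintype α] (w : α → ℝ) : Finset α :=
  Finset.univ.filter fun a => w a ≠ 0

/-- The geometric realization of a (finite) simplicial complex: the points of the standard simplex
spanned by `α` whose support is a simplex, as a subspace of `α → ℝ`. -/
def realization [Fintype α] (K : PreAbstractSimplicialComplex α) : Set (α → ℝ) :=
  {w | w ∈ stdSimplex ℝ α ∧ support w ∈ K}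

lemma pushforward_mem [Fintype α] [Fintype β] [DecidableEq β]
    {K : PreAbstractSimplicialComplex α} {L : PreAbstractSimplicialComplex β} {f : α → β}
    (hf : IsSimplicialMap K L f) {w : α → ℝ} (hw : w ∈ realization K) :
    (fun b => ∑ a with f a = b, w a) ∈ realization L := by
  obtain ⟨⟨h0, h1⟩, hs⟩ := hw
  refine ⟨⟨fun b => Finset.sum_nonneg fun a _ => h0 a, ?_⟩, ?_⟩
  · rw [Finset.sum_fiberwise, h1]
  · convert! hf _ hs using 1
    ext b
    simp only [support, Finset.mem_filter, Finset.mem_univ, true_and, Finset.mem_image, ne_eq]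
    rw [Finset.sum_eq_zero_iff_of_nonneg fun a _ => h0 a]
    simp only [Finset.mem_filter, Finset.mem_univ, true_and, not_forall]
    constructor
    · rintro ⟨a, ha, hne⟩
      exact ⟨a, hne, ha⟩
    · rintro ⟨a, hne, ha⟩
      exact ⟨a, ha, hne⟩

/-- The map of geometric realizations induced by a simplicial map: the affine extension to each
simplex of the map of the vertices. -/
noncomputable def realizationMap [Fintype α] [Fintype β] [DecidableEq β]
    {K : PreAbstractSimplicialComplex α} {L : PreAbstractSimplicialComplex β} {f : α → β}
    (hf : IsSimplicialMap K L f) : C(realization K, realization L) where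
  toFun w := ⟨fun b => ∑ a with f a = b, w.1 a, pushforward_mem hf w.2⟩
  continuous_toFun := by
    refine Continuous.subtype_mk (continuous_pi fun b => ?_) _
    exact continuous_finsetSum _ fun a _ => (continuous_apply a).comp continuous_subtype_val

/-- A continuous map is a homotopy equivalence if it has a homotopy inverse. -/
def IsHomotopyEquiv {X Y : Type*} [TopologicalSpace X] [TopologicalSpace Y] (f : C(X, Y)) : Prop :=
  ∃ g : C(Y, X), (g.comp f).Homotopic (ContinuousMap.id X) ∧
    (f.comp g).Homotopic (ContinuousMap.id Y)

end Realization

/-! ### Complexes of directed forests -/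

section Forests

variable {V : Type*}

/-- A finite set of directed edges `(x, y) = (x → y)` is a directed forest if every vertex is the
head of at most one of the edges and there is no directed cycle (in particular no loop). Then every
connected component is a tree whose edges are directed away from a root. -/
structure IsDirectedForest (s : Finset (V × V)) : Prop where
  tail_unique : ∀ x x' y, (x, y) ∈ s → (x', y) ∈ s → x = x'
  acyclic : ∀ x, ¬ Relation.TransGen (fun a b => (a, b) ∈ s) x x

/-- The complex `Δ(G)` of directed forests of a directed graph `G`: its simplices are the (nonempty)
sets of edges of `G` that form a directed forest. -/
def forestComplex (G : Digraph V) : PreAbstractSimplicialComplex (V × V) where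
  faces := {s | s.Nonempty ∧ (∀ e ∈ s, G.Adj e.1 e.2) ∧ IsDirectedForest s}
  isRelLowerSet_faces := by
    rintro s ⟨hne, hs, hf⟩
    refine ⟨hne, fun r hr hrne => ⟨hrne, fun e he => hs e (hr he), ⟨?_, ?_⟩⟩⟩
    · exact fun x x' y h h' => hf.tail_unique x x' y (hr h) (hr h')
    · exact fun x hx => hf.acyclic x (Relation.TransGen.mono (fun _ _ h => hr h) _ _ hx)

/-- The double directed string `L_t` on the `t + 1` vertices `1, …, t + 1`, with the edges
`i → i + 1` and `i + 1 → i` for `1 ≤ i ≤ t`. The vertex `i` is represented by `i - 1 : Fin (t + 1)`. -/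
def doubleString (t : ℕ) : Digraph (Fin (t + 1)) where
  Adj a b := b.val = a.val + 1 ∨ a.val = b.val + 1

/-- The directed graph `L'_t` on the `t + 2` vertices `1, …, t + 2`, the vertex `i` being represented
by `i - 1 : Fin (t + 2)`. Its edges are the edges of the double directed string on these
vertices which do not point to one of the two end vertices `1` and `t + 2`. For `t ≥ 1` these are
`1 → 2`, `t + 2 → t + 1`, and `i → i + 1`, `i + 1 → i` for `2 ≤ i ≤ t`; for `t = 0` there are none. -/
def augmentedString (t : ℕ) : Digraph (Fin (t + 2)) where
  Adj a b := (b.val = a.val + 1 ∨ a.val = b.val + 1) ∧ b ≠ 0 ∧ b ≠ Fin.last (t + 1)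

/-- The correspondence between the edges of `L_t` and those of `L'_t`. With vertices numbered from
`1` it sends `i + 1 → i` to `i → i + 1`, and `i → i + 1` to `i + 2 → i + 1`. -/
def edgeMap (t : ℕ) (e : Fin (t + 1) × Fin (t + 1)) : Fin (t + 2) × Fin (t + 2) :=
  if e.2 < e.1 then (e.2.castSucc, e.1.castSucc) else (e.2.succ, e.2.castSucc)

end Forests

/-! ### Compositions and the complexes `δ_λ` -/

section Compositions

variable {n m : ℕ}

/-- The refinement order on compositions of `n`: `x ≤ y` if every block of `x` is the sum of
consecutive blocks of `y`, that is, if `x` arises from `y` by gathering together consecutive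
blocks. -/
def RefinedBy (x y : Composition n) : Prop :=
  ∃ b : Composition y.length, y.gather b = x

/-- The set `D_λ` of all compositions of `n` which are less than or equal to some composition of
type `λ`. -/
def compositionPoset (p : n.Partition) : Set (Composition n) :=
  {x | ∃ y : Composition n, Nat.Partition.ofComposition n y = p ∧ RefinedBy x y}

/-- The set of cuts of a composition `[α₁, …, α_l]` of `m + 1`, that is, the set of its partial sums
`α₁ + ⋯ + α_j` with `1 ≤ j < l`. This is a subset of `{1, …, m}`; the number `i` is represented by
`i - 1 : Fin m`. -/
def cuts (x : Composition (m + 1)) : Finset (Fin m) :=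
  Finset.univ.filter fun i => i.succ.castSucc ∈ x.boundaries

lemma mem_boundaries_iff (x : Composition n) (j : Fin (n + 1)) :
    j ∈ x.boundaries ↔ ∃ k ≤ x.length, x.sizeUpTo k = j.val := by
  simp only [Composition.boundaries, Finset.mem_map, Finset.mem_univ, true_and]
  constructor
  · rintro ⟨k, rfl⟩
    exact ⟨k.val, Nat.lt_succ_iff.mp k.2, rfl⟩
  · rintro ⟨k, hk, h⟩
    exact ⟨⟨k, Nat.lt_succ_of_le hk⟩, Fin.ext h⟩

lemma mem_cuts_iff (x : Composition (m + 1)) (i : Fin m) :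
    i ∈ cuts x ↔ ∃ k ≤ x.length, x.sizeUpTo k = i.val + 1 := by
  simp [cuts, mem_boundaries_iff]

lemma sizeUpTo_gather (y : Composition n) (b : Composition y.length) (k : ℕ) (hk : k ≤ b.length) :
    (y.gather b).sizeUpTo k = y.sizeUpTo (b.sizeUpTo k) := by
  rcases hk.lt_or_eq with h | rfl
  · simpa using (Composition.sizeUpTo_sizeUpTo_add y b h
      (Composition.one_le_blocksFun b ⟨k, h⟩)).symm
  · rw [Composition.sizeUpTo_length, Composition.sizeUpTo_length, ← Composition.length_gather y b,
      Composition.sizeUpTo_length]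

lemma mem_cuts_gather (y : Composition (m + 1)) (b : Composition y.length) (i : Fin m) :
    i ∈ cuts (y.gather b) ↔
      ∃ k : Fin (y.length + 1), k ∈ b.boundaries ∧ y.sizeUpTo k = i.val + 1 := by
  rw [mem_cuts_iff]
  constructor
  · rintro ⟨k, hk, h⟩
    rw [Composition.length_gather] at hk
    rw [sizeUpTo_gather y b k hk] at h
    exact ⟨⟨b.sizeUpTo k, Nat.lt_succ_of_le (b.sizeUpTo_le k)⟩,
      (mem_boundaries_iff b _).2 ⟨k, hk, rfl⟩, h⟩
  · rintro ⟨k, hk, h⟩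
    obtain ⟨l, hl, hlk⟩ := (mem_boundaries_iff b k).1 hk
    refine ⟨l, by rwa [Composition.length_gather], ?_⟩
    rw [sizeUpTo_gather y b l hl, hlk, h]

/-- A composition is determined by its cuts. -/
lemma cuts_injective : Function.Injective (cuts : Composition (m + 1) → Finset (Fin m)) := by
  intro x y h
  apply (compositionEquiv (m + 1)).injective
  apply CompositionAsSet.ext
  change x.boundaries = y.boundaries
  ext j
  induction j using Fin.cases with
  | zero => exact iff_of_true x.toCompositionAsSet.zero_mem y.toCompositionAsSet.zero_mem
  | succ j =>
    induction j using Fin.lastCases with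
    | last => exact iff_of_true x.toCompositionAsSet.getLast_mem y.toCompositionAsSet.getLast_mem
    | cast j =>
      have := Finset.ext_iff.1 h j
      simpa [cuts] using this

/-- Every set of cuts contained in the cuts of `y` is the set of cuts of a composition `x ≤ y`. -/
lemma exists_refinedBy_of_subset {y : Composition (m + 1)} {s : Finset (Fin m)}
    (hs : s ⊆ cuts y) : ∃ x, RefinedBy x y ∧ cuts x = s := by
  classical
  let c : CompositionAsSet y.length :=
    { boundaries := Finset.univ.filter fun k =>
        k = 0 ∨ k = Fin.last _ ∨ ∃ i ∈ s, y.sizeUpTo k = i.val + 1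
      zero_mem := by simp
      getLast_mem := by simp }
  refine ⟨y.gather c.toComposition, ⟨_, rfl⟩, ?_⟩
  ext i
  rw [mem_cuts_gather, CompositionAsSet.toComposition_boundaries]
  simp only [c, Finset.mem_filter, Finset.mem_univ, true_and]
  constructor
  · rintro ⟨k, rfl | rfl | ⟨j, hj, hk⟩, h⟩
    · simp at h
    · rw [Fin.val_last, Composition.sizeUpTo_length] at h
      omega
    · have : i = j := Fin.ext (by omega)
      exact this ▸ hj
  · intro hi
    obtain ⟨k, hk, h⟩ := (mem_cuts_iff y i).1 (hs hi)
    exact ⟨⟨k, Nat.lt_succ_of_le hk⟩, Or.inr (Or.inr ⟨i, hi, h⟩), h⟩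

/-- The refinement order is the inclusion of the sets of cuts. -/
lemma refinedBy_iff_cuts_subset (x y : Composition (m + 1)) :
    RefinedBy x y ↔ cuts x ⊆ cuts y := by
  constructor
  · rintro ⟨b, rfl⟩ i hi
    obtain ⟨k, -, h⟩ := (mem_cuts_gather y b i).1 hi
    exact (mem_cuts_iff y i).2 ⟨k, Nat.lt_succ_iff.mp k.2, h⟩
  · intro h
    obtain ⟨z, hz, hc⟩ := exists_refinedBy_of_subset h
    exact cuts_injective hc ▸ hz

/-- The simplicial complex `δ_λ` of a partition `λ` of `m + 1`, whose face poset (with the empty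
simplex included, corresponding to the composition `[m + 1]`) is `D_λ`. Its simplices are the
sets of cuts of the compositions in `D_λ`: a composition is determined by its set of cuts, and the
refinement order corresponds to the inclusion of sets of cuts. -/
def partitionComplex (p : (m + 1).Partition) : PreAbstractSimplicialComplex (Fin m) where
  faces := {s | s.Nonempty ∧ ∃ x ∈ compositionPoset p, cuts x = s}
  isRelLowerSet_faces := by
    rintro s ⟨hne, x, ⟨y, hy, hxy⟩, rfl⟩
    refine ⟨hne, fun r hr hrne => ⟨hrne, ?_⟩⟩
    obtain ⟨z, hz, hc⟩ := exists_refinedBy_of_subset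
      (Finset.Subset.trans hr ((refinedBy_iff_cuts_subset x y).1 hxy))
    exact ⟨z, ⟨y, hy, hz⟩, hc⟩

/-- The partition `(3, 1^t)` of `t + 3`. -/
def threeOnes (t : ℕ) : (t + 2 + 1).Partition where
  parts := 3 ::ₘ Multiset.replicate t 1
  parts_pos := by
    intro i hi
    rcases Multiset.mem_cons.1 hi with rfl | h
    · norm_num
    · rw [Multiset.eq_of_mem_replicate h]
      norm_num
  parts_sum := by
    simp
    omega

end Compositions

end ForestComplex

/-! On a string, every directed cycle contains an edge and its reverse. Hence forest complexes of
subgraphs of strings are flag: a set of edges is a simplex iff no two of them share a head or are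
reverse to each other (`isConflictComplex_forestComplex`). The isomorphism therefore only has to be
checked on pairs of edges; it exchanges the two kinds of conflict.

A homotopy inverse of `φ` is explicit. A point `p` of `δ` gives each edge the weight of its tail;
from each weight the weights of all conflicting edges are subtracted, the result is truncated at `0`
and normalized. Two conflicting edges cannot both survive, so this lands in the forest complex,
provided that some edge survives. It does: otherwise the zeros of `p` at two neighbouring vertices
would spread over the whole string (`exists_conflictReduction_comp_fst_ne_zero`).

Applying `φ` afterwards stays in the closed simplex carrying `p`. For the other composite, the
weights `w` are moved linearly to those pulled back from `φ(w)` and reduced at every time; the edge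
of `exists_edge_forall_conflict` survives throughout. -/

namespace ForestComplex

/-! ### Homotopies between maps into geometric realizations. -/

section Topology

open Topology unitInterval

variable {α β : Type*}

lemma subset_vertices {K : PreAbstractSimplicialComplex α} {s : Finset α} (hs : s ∈ K) :
    (s : Set α) ⊆ vertices K := fun _ ha =>
  (K.isRelLowerSet_faces hs).2 (Finset.singleton_subset_iff.2 ha) (Finset.singleton_nonempty _)

variable [Fintype α] [Fintype β]

lemma mem_support {w : α → ℝ} {a : α} : a ∈ support w ↔ w a ≠ 0 := by
  simp [support]

lemma sum_pos_of_support_mem {K : PreAbstractSimplicialComplex α} {u : α → ℝ}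
    (h0 : ∀ a, 0 ≤ u a) (hu : support u ∈ K) : 0 < ∑ a, u a := by
  obtain ⟨a, ha⟩ := (K.isRelLowerSet_faces hu).1
  exact Finset.sum_pos' (fun a _ => h0 a)
    ⟨a, Finset.mem_univ a, (h0 a).lt_of_ne (Ne.symm (mem_support.1 ha))⟩

lemma normalize_mem_realization {K : PreAbstractSimplicialComplex α} {u : α → ℝ}
    (h0 : ∀ a, 0 ≤ u a) (hu : support u ∈ K) :
    (fun a => u a / ∑ b, u b) ∈ realization K := by
  have hpos := sum_pos_of_support_mem h0 hu
  refine ⟨⟨fun a => div_nonneg (h0 a) hpos.le, ?_⟩, ?_⟩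
  · rw [← Finset.sum_div, div_self hpos.ne']
  · convert hu using 1
    ext a
    simp [mem_support, hpos.ne']

/-- The map into a realization obtained by normalizing a family of weights. -/
noncomputable def normalize {X : Type*} [TopologicalSpace X] {K : PreAbstractSimplicialComplex α}
    (u : X → α → ℝ) (hc : Continuous u) (h0 : ∀ x a, 0 ≤ u x a) (hu : ∀ x, support (u x) ∈ K) :
    C(X, realization K) where
  toFun x := ⟨fun a => u x a / ∑ b, u x b, normalize_mem_realization (h0 x) (hu x)⟩
  continuous_toFun := by
    have hc' : ∀ a, Continuous fun x => u x a := fun a => (continuous_apply a).comp hc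
    refine Continuous.subtype_mk (continuous_pi fun a => ?_) _
    exact (hc' a).div (continuous_finsetSum _ fun b _ => hc' b)
      fun x => (sum_pos_of_support_mem (h0 x) (hu x)).ne'

/-- A family of weights supported on simplices gives a homotopy between the normalizations of its
two ends. -/
lemma homotopic_of_weights {X : Type*} [TopologicalSpace X] {K : PreAbstractSimplicialComplex α}
    {F G : C(X, realization K)} (u : I × X → α → ℝ) (hc : Continuous u)
    (h0 : ∀ x a, 0 ≤ u x a) (hu : ∀ x, support (u x) ∈ K)
    (hF : ∀ x a, u (0, x) a / ∑ b, u (0, x) b = (F x).1 a)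
    (hG : ∀ x a, u (1, x) a / ∑ b, u (1, x) b = (G x).1 a) : F.Homotopic G :=
  ⟨{ toContinuousMap := normalize u hc h0 hu
     map_zero_left := fun x => Subtype.ext (funext (hF x))
     map_one_left := fun x => Subtype.ext (funext (hG x)) }⟩

/-- Two maps into a realization such that the images of every point lie in a common closed simplex
are homotopic. -/
lemma homotopic_of_common_simplex {X : Type*} [TopologicalSpace X]
    {K : PreAbstractSimplicialComplex α} {F G : C(X, realization K)}
    (h : ∀ x, ∃ s ∈ K, support (F x).1 ⊆ s ∧ support (G x).1 ⊆ s) : F.Homotopic G := by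
  have h0 : ∀ (y : I × X) (a : α), 0 ≤ (1 - y.1.1) * (F y.2).1 a + y.1.1 * (G y.2).1 a :=
    fun y a => add_nonneg (mul_nonneg (sub_nonneg.2 y.1.2.2) ((F y.2).2.1.1 a))
      (mul_nonneg y.1.2.1 ((G y.2).2.1.1 a))
  have h1 : ∀ y : I × X, ∑ a, ((1 - y.1.1) * (F y.2).1 a + y.1.1 * (G y.2).1 a) = 1 := by
    intro y
    rw [Finset.sum_add_distrib, ← Finset.mul_sum, ← Finset.mul_sum, (F y.2).2.1.2, (G y.2).2.1.2]
    ring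
  refine homotopic_of_weights (fun y a => (1 - y.1.1) * (F y.2).1 a + y.1.1 * (G y.2).1 a)
    (continuous_pi fun a => ?_) h0 (fun y => ?_) (fun x a => ?_) (fun x a => ?_)
  · have hF : Continuous fun y : I × X => (F y.2).1 a :=
      (continuous_apply a).comp (continuous_subtype_val.comp (F.continuous.comp continuous_snd))
    have hG : Continuous fun y : I × X => (G y.2).1 a :=
      (continuous_apply a).comp (continuous_subtype_val.comp (G.continuous.comp continuous_snd))
    have hs : Continuous fun y : I × X => y.1.1 := continuous_subtype_val.comp continuous_fst
    exact ((continuous_const.sub hs).mul hF).add (hs.mul hG)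
  · obtain ⟨s, hs, hFs, hGs⟩ := h y.2
    refine ((K.isRelLowerSet_faces hs).2 (fun a ha => ?_) ?_)
    · by_contra has
      have hFa : (F y.2).1 a = 0 := by
        by_contra hne
        exact has (hFs (mem_support.2 hne))
      have hGa : (G y.2).1 a = 0 := by
        by_contra hne
        exact has (hGs (mem_support.2 hne))
      exact mem_support.1 ha (by simp [hFa, hGa])
    · by_contra hne
      rw [Finset.not_nonempty_iff_eq_empty] at hne
      have := h1 y
      rw [Finset.sum_eq_zero fun a _ => ?_] at this
      · exact zero_ne_one this
      · by_contra ha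
        exact Finset.notMem_empty a (hne ▸ mem_support.2 ha)
  · rw [h1 (0, x)]
    simp
  · rw [h1 (1, x)]
    simp

lemma IsHomotopyEquiv.comp {X Y Z : Type*} [TopologicalSpace X] [TopologicalSpace Y]
    [TopologicalSpace Z] {f : C(Y, Z)} {e : C(X, Y)} (hf : IsHomotopyEquiv f)
    (he : IsHomotopyEquiv e) : IsHomotopyEquiv (f.comp e) := by
  obtain ⟨g, hgf, hfg⟩ := hf
  obtain ⟨d, hde, hed⟩ := he
  refine ⟨d.comp g, ?_, ?_⟩
  · have := ((ContinuousMap.Homotopic.refl d).comp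
      (hgf.comp (ContinuousMap.Homotopic.refl e))).trans hde
    exact this
  · have := ((ContinuousMap.Homotopic.refl f).comp
      (hed.comp (ContinuousMap.Homotopic.refl g))).trans hfg
    exact this

lemma support_realizationMap [DecidableEq β] {K : PreAbstractSimplicialComplex α}
    {L : PreAbstractSimplicialComplex β} {f : α → β} (hf : IsSimplicialMap K L f)
    (w : realization K) : support (realizationMap hf w).1 ⊆ (support w.1).image f := by
  intro b hb
  have hb' : ∑ a with f a = b, w.1 a ≠ 0 := mem_support (w := (realizationMap hf w).1).1 hb
  obtain ⟨a, ha, hne⟩ := Finset.exists_ne_zero_of_sum_ne_zero hb'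
  exact Finset.mem_image.2 ⟨a, mem_support.2 hne, (Finset.mem_filter.1 ha).2⟩

lemma IsSimplicialIso.isHomotopyEquiv [DecidableEq α] [DecidableEq β]
    {K : PreAbstractSimplicialComplex α} {L : PreAbstractSimplicialComplex β} {f : α → β}
    (hf : IsSimplicialIso K L f) : IsHomotopyEquiv (realizationMap hf.isSimplicialMap) := by
  -- `Function.invFunOn` needs a nonempty domain; if `α` is empty, both realizations are empty.
  rcases isEmpty_or_nonempty α with hα | hα
  · have hK : IsEmpty (realization K) := ⟨fun w => by simpa using w.2.1.2⟩
    have hL : IsEmpty (realization L) := ⟨fun w => by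
      obtain ⟨b, hb⟩ := (L.isRelLowerSet_faces w.2.2).1
      obtain ⟨a, -⟩ := hf.bijOn.surjOn (subset_vertices w.2.2 hb)
      exact isEmptyElim a⟩
    exact ⟨⟨fun y => isEmptyElim y, continuous_of_const fun y => isEmptyElim y⟩,
      homotopic_of_common_simplex fun x => isEmptyElim x,
      homotopic_of_common_simplex fun x => isEmptyElim x⟩
  set g := Function.invFunOn f (vertices K)
  have hinv : Set.InvOn g f (vertices K) (vertices L) := hf.bijOn.invOn_invFunOn
  have hgm : Set.MapsTo g (vertices L) (vertices K) := hf.bijOn.surjOn.mapsTo_invFunOn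
  have himage : ∀ s ∈ L, (s.image g).image f = s := by
    intro s hs
    rw [Finset.image_image]
    conv_rhs => rw [← Finset.image_id (s := s)]
    exact Finset.image_congr fun b hb => hinv.2 (subset_vertices hs hb)
  have himage' : ∀ s ∈ K, (s.image f).image g = s := by
    intro s hs
    rw [Finset.image_image]
    conv_rhs => rw [← Finset.image_id (s := s)]
    exact Finset.image_congr fun b hb => hinv.1 (subset_vertices hs hb)
  have hgs : IsSimplicialMap L K g := fun s hs => by
    refine (hf.image_mem_iff _ ?_).1 ((himage s hs).symm ▸ hs)
    intro a ha
    obtain ⟨b, hb, rfl⟩ := Finset.mem_image.1 ha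
    exact hgm (subset_vertices hs hb)
  refine ⟨realizationMap hgs, homotopic_of_common_simplex fun w => ⟨_, w.2.2, ?_, subset_rfl⟩,
    homotopic_of_common_simplex fun w => ⟨_, w.2.2, ?_, subset_rfl⟩⟩
  · conv_rhs => rw [← himage' _ w.2.2]
    exact (support_realizationMap hgs _).trans
      (Finset.image_subset_image (support_realizationMap _ _))
  · conv_rhs => rw [← himage _ w.2.2]
    exact (support_realizationMap hf.isSimplicialMap _).trans
      (Finset.image_subset_image (support_realizationMap hgs _))

end Topology

/-! ### Flag complexes and the reduction of conflicts. -/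

section Flag

open unitInterval

variable {α β : Type*} [Fintype α] [Fintype β]

/-- `K` is the flag complex on the vertices satisfying `A`, whose simplices are the sets of vertices
no two of which are in the relation `C`. -/
def IsConflictComplex (K : PreAbstractSimplicialComplex α) (A : α → Prop) (C : α → α → Prop) :
    Prop :=
  ∀ s : Finset α, s ∈ K ↔ s.Nonempty ∧ (∀ a ∈ s, A a) ∧ ∀ a ∈ s, ∀ b ∈ s, ¬ C a b

open Classical in
/-- From the weight of every vertex satisfying `A` the weights of the conflicting ones are
subtracted, as far as possible. -/
noncomputable def conflictReduction (A : α → Prop) (C : α → α → Prop) (u : α → ℝ) (a : α) : ℝ :=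
  if A a then max 0 (u a - ∑ b with A b ∧ C a b, u b) else 0

variable {A : α → Prop} {C : α → α → Prop} {K : PreAbstractSimplicialComplex α}

lemma conflictReduction_nonneg (u : α → ℝ) (a : α) : 0 ≤ conflictReduction A C u a := by
  unfold conflictReduction
  split_ifs
  · exact le_max_left _ _
  · exact le_rfl

lemma continuous_conflictReduction : Continuous (conflictReduction A C) := by
  refine continuous_pi fun a => ?_
  unfold conflictReduction
  split_ifs
  · exact continuous_const.max ((continuous_apply a).sub
      (continuous_finsetSum _ fun b _ => continuous_apply b))
  · exact continuous_const

open Classical in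
lemma sum_lt_of_conflictReduction_ne_zero {u : α → ℝ} {a : α}
    (h : conflictReduction A C u a ≠ 0) :
    A a ∧ ∑ b with A b ∧ C a b, u b < u a := by
  unfold conflictReduction at h
  split_ifs at h with ha
  · refine ⟨ha, ?_⟩
    by_contra! hle
    exact h (max_eq_left (sub_nonpos.2 hle))
  · exact absurd rfl h

lemma conflictReduction_pos {u : α → ℝ} {a : α} (ha : A a) (hpos : 0 < u a)
    (h : ∀ b, A b → C a b → u b = 0) : conflictReduction A C u a ≠ 0 := by
  classical
  unfold conflictReduction
  rw [if_pos ha, Finset.sum_eq_zero fun b hb => h b (Finset.mem_filter.1 hb).2.1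
    (Finset.mem_filter.1 hb).2.2, sub_zero, max_eq_right hpos.le]
  exact hpos.ne'

lemma pos_of_conflictReduction_ne_zero {u : α → ℝ} (h0 : ∀ a, 0 ≤ u a) {a : α}
    (h : conflictReduction A C u a ≠ 0) : 0 < u a := by
  classical
  exact (Finset.sum_nonneg fun b _ => h0 b).trans_lt (sum_lt_of_conflictReduction_ne_zero h).2

/-- If two conflicting vertices both survived, the weight of each would be strictly larger than that
of the other. -/
lemma support_conflictReduction_mem (hK : IsConflictComplex K A C) (hC : ∀ a b, C a b → C b a)
    {u : α → ℝ} (h0 : ∀ a, 0 ≤ u a) (hne : ∃ a, conflictReduction A C u a ≠ 0) :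
    support (conflictReduction A C u) ∈ K := by
  classical
  obtain ⟨a, ha⟩ := hne
  refine (hK _).2 ⟨⟨a, mem_support.2 ha⟩, fun b hb =>
    (sum_lt_of_conflictReduction_ne_zero (mem_support.1 hb)).1, fun b hb c hc hbc => ?_⟩
  obtain ⟨hAb, hb⟩ := sum_lt_of_conflictReduction_ne_zero (mem_support.1 hb)
  obtain ⟨hAc, hc⟩ := sum_lt_of_conflictReduction_ne_zero (mem_support.1 hc)
  have h1 : u c < u b := (Finset.single_le_sum (f := u) (fun x _ => h0 x)
    (by simp [hAc, hbc])).trans_lt hb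
  have h2 : u b < u c := (Finset.single_le_sum (f := u) (fun x _ => h0 x)
    (by simp [hAb, hC _ _ hbc])).trans_lt hc
  exact lt_asymm h1 h2

/-- The support of `w` is free of conflicts, so only zeros are subtracted. This makes the homotopy
of weights start at the identity. -/
lemma conflictReduction_eq_self (hK : IsConflictComplex K A C) {w : α → ℝ}
    (hw : w ∈ realization K) : conflictReduction A C w = w := by
  classical
  obtain ⟨-, hA, hC⟩ := (hK _).1 hw.2
  ext a
  by_cases ha : w a = 0
  · by_contra hne
    exact (pos_of_conflictReduction_ne_zero hw.1.1 (ha ▸ hne)).ne' ha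
  · have ha' := mem_support.2 ha
    unfold conflictReduction
    rw [if_pos (hA a ha'), Finset.sum_eq_zero fun b hb => ?_, sub_zero,
      max_eq_right (hw.1.1 a)]
    by_contra hb'
    exact hC a ha' b (mem_support.2 hb') (Finset.mem_filter.1 hb).2.2

/-- Criterion for a simplicial map `f` from a flag complex to be a homotopy equivalence. A homotopy
inverse is obtained by pulling weights back along `f` and reducing the conflicts. -/
theorem isHomotopyEquiv_of_conflictReduction_ne_zero [DecidableEq β]
    {L : PreAbstractSimplicialComplex β} {f : α → β} (hK : IsConflictComplex K A C)
    (hC : ∀ a b, C a b → C b a) (hf : IsSimplicialMap K L f)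
    (h₁ : ∀ p ∈ realization L, ∃ a, conflictReduction A C (fun a => p (f a)) a ≠ 0)
    (h₂ : ∀ w ∈ realization K, ∀ s : I,
      ∃ a, conflictReduction A C
        (fun a => (1 - s.1) * w a + s.1 * ∑ b with f b = f a, w b) a ≠ 0) :
    IsHomotopyEquiv (realizationMap hf) := by
  -- `h₁` says that this normalization is defined; `h₂` says the same for each stage of the homotopy
  -- from the identity to the composite of `g` after `f`.
  let g : C(realization L, realization K) :=
    normalize (fun p => conflictReduction A C fun a => p.1 (f a))
      (continuous_conflictReduction.comp (continuous_pi fun a =>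
        (continuous_apply (f a)).comp continuous_subtype_val))
      (fun p a => conflictReduction_nonneg _ a)
      (fun p => support_conflictReduction_mem hK hC (fun a => p.2.1.1 _) (h₁ p.1 p.2))
  have hg : ∀ p, support (g p).1 ⊆ support (conflictReduction A C fun a => p.1 (f a)) := by
    intro p a ha
    refine mem_support.2 fun h => mem_support.1 ha ?_
    change conflictReduction A C (fun a => p.1 (f a)) a / _ = 0
    rw [h, zero_div]
  refine ⟨g, ContinuousMap.Homotopic.symm (homotopic_of_weights
    (fun y : I × realization K => conflictReduction A C
      (fun a => (1 - y.1.1) * y.2.1 a + y.1.1 * ∑ b with f b = f a, y.2.1 b))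
    (continuous_conflictReduction.comp (continuous_pi fun a => ?_))
    (fun y a => conflictReduction_nonneg _ a)
    (fun y => support_conflictReduction_mem hK hC (fun a => ?_) (h₂ y.2.1 y.2.2 y.1))
    (fun w a => ?_) (fun w a => ?_)), homotopic_of_common_simplex fun p =>
      ⟨_, p.2.2, ?_, subset_rfl⟩⟩
  · have hc : ∀ b, Continuous fun y : I × realization K => y.2.1 b := fun b =>
      (continuous_apply b).comp (continuous_subtype_val.comp continuous_snd)
    have hs : Continuous fun y : I × realization K => ∑ b with f b = f a, y.2.1 b :=
      continuous_finsetSum _ fun b _ => hc b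
    have ht : Continuous fun y : I × realization K => y.1.1 :=
      continuous_subtype_val.comp continuous_fst
    exact ((continuous_const.sub ht).mul (hc a)).add (ht.mul hs)
  · exact add_nonneg (mul_nonneg (sub_nonneg.2 y.1.2.2) (y.2.2.1.1 a))
      (mul_nonneg y.1.2.1 (Finset.sum_nonneg fun b _ => y.2.2.1.1 b))
  · have h : conflictReduction A C (fun a => (1 - (0 : ℝ)) * w.1 a +
        0 * ∑ b with f b = f a, w.1 b) = w.1 := by
      simpa using conflictReduction_eq_self hK w.2
    have h' : ∑ b, w.1 b = 1 := w.2.1.2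
    simp only [Set.Icc.coe_zero, h, h', div_one, ContinuousMap.id_apply]
  · simp only [Set.Icc.coe_one, sub_self, zero_mul, one_mul, zero_add]
    rfl
  -- A surviving vertex `a` has positive weight `p (f a)`, so `f` maps the support of `g p` into
  -- that of `p`.
  · refine (support_realizationMap hf _).trans fun b hb => ?_
    obtain ⟨a, ha, rfl⟩ := Finset.mem_image.1 hb
    exact mem_support.2 (pos_of_conflictReduction_ne_zero (u := fun a => p.1 (f a))
      (fun a => p.2.1.1 _) (mem_support.1 (hg p ha))).ne'

end Flag

/-! ### Edges of strings, cuts of compositions, and the map to tails. -/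

section Combinatorics

/-- Two edges are in conflict if they have the same head, or if they are reverse to each other. -/
def EdgeConflict {V : Type*} (e e' : V × V) : Prop :=
  (e.1 ≠ e'.1 ∧ e.2 = e'.2) ∨ (e.1 = e'.2 ∧ e.2 = e'.1)

lemma EdgeConflict.symm {V : Type*} (e e' : V × V) (h : EdgeConflict e e') :
    EdgeConflict e' e := by
  rcases h with ⟨h, h'⟩ | ⟨h, h'⟩
  · exact Or.inl ⟨h.symm, h'.symm⟩
  · exact Or.inr ⟨h'.symm, h.symm⟩

/-- In a digraph all of whose edges connect neighbouring vertices of a string, every cycle contains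
an edge together with its reverse. -/
lemma isConflictComplex_forestComplex {n : ℕ} (G : Digraph (Fin n))
    (hG : ∀ a b, G.Adj a b → b.val = a.val + 1 ∨ a.val = b.val + 1) :
    IsConflictComplex (forestComplex G) (fun e => G.Adj e.1 e.2) EdgeConflict := by
  intro s
  refine and_congr_right fun _ => and_congr_right fun hA => ?_
  constructor
  · rintro ⟨h1, h2⟩ ⟨a, b⟩ he ⟨a', b'⟩ he' (⟨hne, heq⟩ | ⟨hab, hba⟩)
    · obtain rfl : b = b' := heq
      exact hne (h1 _ _ _ he he')
    · obtain rfl : a = b' := hab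
      obtain rfl : b = a' := hba
      exact h2 a (.tail (.single he) he')
  · intro hC
    refine ⟨fun x x' y h h' => ?_, fun x hx => ?_⟩
    · by_contra hne
      exact hC _ h _ h' (Or.inl ⟨hne, rfl⟩)
    -- A walk that never reverses an edge keeps its direction: its end lies strictly on one side of
    -- `x` and was entered from the neighbour on the side of `x`.
    · have key : ∀ y, Relation.TransGen (fun a b => (a, b) ∈ s) x y →
          (x < y ∧ ∃ z, z.val + 1 = y.val ∧ (z, y) ∈ s) ∨
            (y < x ∧ ∃ z, z.val = y.val + 1 ∧ (z, y) ∈ s) := by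
        intro y hy
        induction hy with
        | single h =>
          rcases hG _ _ (hA _ h) with h' | h'
          · exact Or.inl ⟨Fin.lt_def.2 (by simp at h'; omega), x, h'.symm, h⟩
          · exact Or.inr ⟨Fin.lt_def.2 (by simp at h'; omega), x, h', h⟩
        | @tail b c _ h ih =>
          have hbc := hG _ _ (hA _ h)
          have hrev : (c, b) ∉ s := fun h' => hC _ h _ h' (Or.inr ⟨rfl, rfl⟩)
          simp only at hbc
          rcases ih with ⟨hlt, z, hz, hzs⟩ | ⟨hlt, z, hz, hzs⟩ <;> rcases hbc with h' | h'
          · exact Or.inl ⟨Fin.lt_def.2 (by have := Fin.lt_def.1 hlt; omega), b, h'.symm, h⟩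
          · exact absurd ((Fin.ext (by omega) : z = c) ▸ hzs) hrev
          · exact absurd ((Fin.ext (by omega) : z = c) ▸ hzs) hrev
          · exact Or.inr ⟨Fin.lt_def.2 (by have := Fin.lt_def.1 hlt; omega), b, h', h⟩
      rcases key x hx with h | h
      · exact lt_irrefl _ h.1
      · exact lt_irrefl _ h.1

lemma isConflictComplex_doubleString (t : ℕ) :
    IsConflictComplex (forestComplex (doubleString t))
      (fun e => (doubleString t).Adj e.1 e.2) EdgeConflict :=
  isConflictComplex_forestComplex _ fun _ _ h => h

lemma isConflictComplex_augmentedString (t : ℕ) :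
    IsConflictComplex (forestComplex (augmentedString t))
      (fun e => (augmentedString t).Adj e.1 e.2) EdgeConflict :=
  isConflictComplex_forestComplex _ fun _ _ h => h.1

lemma IsConflictComplex.mem_vertices_iff {α : Type*} [Fintype α]
    {K : PreAbstractSimplicialComplex α} {A : α → Prop} {C : α → α → Prop}
    (hK : IsConflictComplex K A C) (a : α) : a ∈ vertices K ↔ A a ∧ ¬ C a a := by
  simp [vertices, hK _]

/-- A bijection of the vertices under which the conflicts correspond to each other is an
isomorphism of flag complexes. -/
lemma isSimplicialIso_of_conflict_iff {α β : Type*} [Fintype α] [Fintype β] [DecidableEq β]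
    {K : PreAbstractSimplicialComplex α} {L : PreAbstractSimplicialComplex β}
    {A : α → Prop} {C : α → α → Prop} {B : β → Prop} {D : β → β → Prop}
    (hK : IsConflictComplex K A C) (hL : IsConflictComplex L B D)
    {f : α → β} (hf : Set.BijOn f (vertices K) (vertices L))
    (hD : ∀ a b, A a → A b → (D (f a) (f b) ↔ C a b)) : IsSimplicialIso K L f := by
  refine ⟨hf, fun s hs => ?_⟩
  have hA : ∀ a ∈ s, A a := fun a ha => ((hK.mem_vertices_iff a).1 (hs ha)).1
  have hB : ∀ a ∈ s, B (f a) := fun a ha => ((hL.mem_vertices_iff _).1 (hf.mapsTo (hs ha))).1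
  rw [hK, hL]
  simp only [Finset.image_nonempty, Finset.forall_mem_image]
  refine and_congr_right fun _ => ?_
  simp only [iff_true_intro hA, iff_true_intro hB, true_and]
  exact forall₂_congr fun a ha => forall₂_congr fun b hb => not_congr (hD a b (hA a ha) (hA b hb))

lemma edgeMap_of_lt {t : ℕ} {a b : Fin (t + 1)} (h : b < a) :
    edgeMap t (a, b) = (b.castSucc, a.castSucc) := if_pos h

lemma edgeMap_of_le {t : ℕ} {a b : Fin (t + 1)} (h : a ≤ b) :
    edgeMap t (a, b) = (b.succ, b.castSucc) := if_neg (not_lt.2 h)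

lemma mem_vertices_doubleString {t : ℕ} {e : Fin (t + 1) × Fin (t + 1)} :
    e ∈ vertices (forestComplex (doubleString t)) ↔ (doubleString t).Adj e.1 e.2 := by
  rw [(isConflictComplex_doubleString t).mem_vertices_iff, and_iff_left_of_imp]
  rintro h (⟨h', -⟩ | ⟨h', -⟩)
  · exact h' rfl
  · rcases h with h | h <;> rw [h'] at h <;> omega

lemma mem_vertices_augmentedString {t : ℕ} {e : Fin (t + 2) × Fin (t + 2)} :
    e ∈ vertices (forestComplex (augmentedString t)) ↔ (augmentedString t).Adj e.1 e.2 := by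
  rw [(isConflictComplex_augmentedString t).mem_vertices_iff, and_iff_left_of_imp]
  rintro h (⟨h', -⟩ | ⟨h', -⟩)
  · exact h' rfl
  · rcases h.1 with h | h <;> rw [h'] at h <;> omega

lemma augmentedString_adj_iff {t : ℕ} {a b : Fin (t + 2)} :
    (augmentedString t).Adj a b ↔
      (b.val = a.val + 1 ∨ a.val = b.val + 1) ∧ 0 < b.val ∧ b.val ≤ t := by
  refine and_congr_right fun _ => ?_
  simp only [ne_eq, Fin.ext_iff, Fin.val_zero, Fin.val_last]
  omega

/-- Reverse edges go to edges with a common head, and edges with a common head go to reverse edges.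
-/
lemma edgeConflict_edgeMap_iff {t : ℕ} (e e' : Fin (t + 1) × Fin (t + 1))
    (he : (doubleString t).Adj e.1 e.2) (he' : (doubleString t).Adj e'.1 e'.2) :
    EdgeConflict (edgeMap t e) (edgeMap t e') ↔ EdgeConflict e e' := by
  obtain ⟨a, b⟩ := e
  obtain ⟨a', b'⟩ := e'
  simp only [doubleString] at he he'
  rcases lt_or_ge b a with h | h <;> rcases lt_or_ge b' a' with h' | h' <;>
    simp only [edgeMap_of_lt, edgeMap_of_le, h, h', EdgeConflict, Fin.ext_iff, Fin.val_succ,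
      Fin.val_castSucc, ne_eq] <;>
    simp only [Fin.lt_def, Fin.le_def] at h h' <;> omega

lemma bijOn_edgeMap (t : ℕ) : Set.BijOn (edgeMap t) (vertices (forestComplex (doubleString t)))
    (vertices (forestComplex (augmentedString t))) := by
  refine ⟨?_, ?_, ?_⟩
  · rintro ⟨a, b⟩ he
    rw [mem_vertices_doubleString] at he
    rw [mem_vertices_augmentedString, augmentedString_adj_iff]
    simp only [doubleString] at he
    rcases lt_or_ge b a with h | h <;>
      simp only [edgeMap_of_lt, edgeMap_of_le, h, Fin.val_succ, Fin.val_castSucc, or_true,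
        true_and] <;>
      simp only [Fin.lt_def, Fin.le_def] at h <;> omega
  · rintro ⟨a, b⟩ he ⟨a', b'⟩ he' heq
    rw [mem_vertices_doubleString] at he he'
    simp only [doubleString] at he he'
    rcases lt_or_ge b a with h | h <;> rcases lt_or_ge b' a' with h' | h' <;>
      simp only [edgeMap_of_lt, edgeMap_of_le, h, h', Prod.ext_iff, Fin.ext_iff, Fin.val_succ,
        Fin.val_castSucc] at heq ⊢ <;>
      simp only [Fin.lt_def, Fin.le_def] at h h' <;> omega
  · rintro ⟨x, y⟩ he
    rw [mem_vertices_augmentedString, augmentedString_adj_iff] at he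
    obtain ⟨h | h, h0, ht⟩ := he
    · simp only at h h0 ht
      refine ⟨(⟨y.val, by omega⟩, ⟨x.val, by omega⟩), ?_, ?_⟩
      · rw [mem_vertices_doubleString]
        exact Or.inr h
      · rw [edgeMap_of_lt (Fin.lt_def.2 (by simp only; omega))]
        rfl
    · simp only at h h0 ht
      refine ⟨(⟨y.val - 1, by omega⟩, ⟨y.val, by omega⟩), ?_, ?_⟩
      · rw [mem_vertices_doubleString]
        exact Or.inl (by simp only; omega)
      · rw [edgeMap_of_le (Fin.le_def.2 (by simp only; omega))]
        exact Prod.ext (Fin.ext h.symm) rfl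

lemma isSimplicialIso_edgeMap (t : ℕ) : IsSimplicialIso (forestComplex (doubleString t))
    (forestComplex (augmentedString t)) (edgeMap t) :=
  isSimplicialIso_of_conflict_iff (isConflictComplex_doubleString t)
    (isConflictComplex_augmentedString t) (bijOn_edgeMap t) edgeConflict_edgeMap_iff

/-- A composition of type `(3, 1^t)` has two consecutive integers which are not cuts. -/
lemma exists_notMem_cuts {t : ℕ} {y : Composition (t + 2 + 1)}
    (hy : Nat.Partition.ofComposition _ y = threeOnes t) :
    ∃ i : Fin (t + 1), i.castSucc ∉ cuts y ∧ i.succ ∉ cuts y := by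
  have hmem : 3 ∈ y.blocks := by
    have h : (3 : ℕ) ∈ (threeOnes t).parts :=
      Multiset.mem_cons_self 3 (Multiset.replicate t 1)
    rw [← hy] at h
    simpa using h
  obtain ⟨k, hk, h3⟩ := List.getElem_of_mem hmem
  have hstep : y.sizeUpTo (k + 1) = y.sizeUpTo k + 3 := by
    rw [y.sizeUpTo_succ hk, h3]
  have hle : y.sizeUpTo (k + 1) ≤ t + 2 + 1 := y.sizeUpTo_le _
  -- The index `j` stands for the cut `j + 1`, which here lies strictly between the partial sums
  -- before and after the block `3`.
  have hnot : ∀ j : Fin (t + 2), y.sizeUpTo k ≤ j.val → j.val < y.sizeUpTo k + 2 →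
      j ∉ cuts y := by
    intro j h1 h2 hj
    obtain ⟨l, -, hl⟩ := (mem_cuts_iff y j).1 hj
    rcases Nat.lt_or_ge k l with hkl | hkl
    · have := y.monotone_sizeUpTo (show k + 1 ≤ l from hkl)
      omega
    · have := y.monotone_sizeUpTo hkl
      omega
  refine ⟨⟨y.sizeUpTo k, by omega⟩, hnot _ ?_ ?_, hnot _ ?_ ?_⟩ <;>
    simp only [Fin.val_castSucc, Fin.val_succ] <;> omega

/-- The composition `[1, …, 1, 3, 1, …, 1]` with `i` ones before the `3`. -/
def threeOnesComposition (t : ℕ) (i : Fin (t + 1)) : Composition (t + 2 + 1) where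
  blocks := List.replicate i 1 ++ 3 :: List.replicate (t - i) 1
  blocks_pos := by
    intro j hj
    simp only [List.mem_append, List.mem_replicate, List.mem_cons] at hj
    omega
  blocks_sum := by
    simp
    omega

lemma ofComposition_threeOnesComposition (t : ℕ) (i : Fin (t + 1)) :
    Nat.Partition.ofComposition _ (threeOnesComposition t i) = threeOnes t := by
  apply Nat.Partition.ext
  have h : (List.replicate i.val 1 ++ 3 :: List.replicate (t - i.val) 1).Perm
      (3 :: List.replicate t 1) := by
    refine List.perm_middle.trans (List.Perm.cons 3 ?_)
    rw [← List.replicate_add, Nat.add_sub_cancel' (Nat.lt_succ_iff.1 i.2)]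
  change ((List.replicate i.val 1 ++ 3 :: List.replicate (t - i.val) 1 : List ℕ) : Multiset ℕ) =
    3 ::ₘ Multiset.replicate t 1
  rw [Multiset.coe_eq_coe.2 h, ← Multiset.cons_coe, Multiset.coe_replicate]

lemma mem_cuts_threeOnesComposition {t : ℕ} {i : Fin (t + 1)} {j : Fin (t + 2)}
    (h1 : j ≠ i.castSucc) (h2 : j ≠ i.succ) : j ∈ cuts (threeOnesComposition t i) := by
  rw [mem_cuts_iff]
  rw [ne_eq, Fin.ext_iff] at h1 h2
  simp only [Fin.val_castSucc, Fin.val_succ] at h1 h2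
  have hlen : (threeOnesComposition t i).length = t + 1 := by
    simp [threeOnesComposition, Composition.length]
    omega
  rcases Nat.lt_or_ge j.val i.val with h | h
  · refine ⟨j.val + 1, by omega, ?_⟩
    simp only [Composition.sizeUpTo, threeOnesComposition]
    rw [List.take_append_of_le_length (by simp; omega), List.take_replicate]
    simp
    omega
  · obtain ⟨d, hd⟩ : ∃ d, j.val = i.val + 2 + d := ⟨j.val - i.val - 2, by omega⟩
    -- These blocks are `i` ones, the `3` and `d` further ones, with sum `i + 3 + d = j + 1`.
    refine ⟨i.val + 1 + d, by omega, ?_⟩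
    simp only [Composition.sizeUpTo, threeOnesComposition]
    rw [show i.val + 1 + d = (List.replicate i.val 1).length + (d + 1) by simp; omega,
      List.take_length_add_append, List.take_succ_cons, List.take_replicate]
    simp
    omega

/-- The simplices of `δ_λ` for `λ = (3, 1^t)`. -/
lemma mem_partitionComplex_threeOnes {t : ℕ} {s : Finset (Fin (t + 2))} :
    s ∈ partitionComplex (threeOnes t) ↔
      s.Nonempty ∧ ∃ i : Fin (t + 1), i.castSucc ∉ s ∧ i.succ ∉ s := by
  refine and_congr_right fun _ => ⟨?_, ?_⟩
  · rintro ⟨x, ⟨y, hy, hxy⟩, rfl⟩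
    obtain ⟨i, h1, h2⟩ := exists_notMem_cuts hy
    have hsub := (refinedBy_iff_cuts_subset x y).1 hxy
    exact ⟨i, fun h => h1 (hsub h), fun h => h2 (hsub h)⟩
  · rintro ⟨i, h1, h2⟩
    obtain ⟨x, hx, hs⟩ := exists_refinedBy_of_subset (y := threeOnesComposition t i) (s := s)
      fun j hj => mem_cuts_threeOnesComposition (fun h => h1 (h ▸ hj)) fun h => h2 (h ▸ hj)
    exact ⟨x, ⟨_, ofComposition_threeOnesComposition t i, hx⟩, hs⟩

/-- If the tails met every pair of neighbouring vertices, an upward edge at the lower end would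
force upward edges all along the string, the last of them with a forbidden head. -/
lemma isSimplicialMap_fst (t : ℕ) : IsSimplicialMap (forestComplex (augmentedString t))
    (partitionComplex (threeOnes t)) (fun e => e.1) := by
  intro s hs
  obtain ⟨hne, hA, hC⟩ := (isConflictComplex_augmentedString t s).1 hs
  refine mem_partitionComplex_threeOnes.2 ⟨hne.image _, ?_⟩
  by_contra! h
  have htail : ∀ k (hk : k < t + 1), ∃ e ∈ s, e.1.val = k ∨ e.1.val = k + 1 := by
    intro k hk
    by_cases hk' : (⟨k, hk⟩ : Fin (t + 1)).castSucc ∈ s.image fun e => e.1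
    · obtain ⟨e, he, heq⟩ := Finset.mem_image.1 hk'
      exact ⟨e, he, Or.inl (by simp [heq])⟩
    · obtain ⟨e, he, heq⟩ := Finset.mem_image.1 (h _ hk')
      exact ⟨e, he, Or.inr (by simp [heq])⟩
  have key : ∀ k < t + 1, ∃ e ∈ s, e.2.val = e.1.val + 1 ∧ (e.1.val = k ∨ e.1.val = k + 1) := by
    intro k
    induction k with
    | zero =>
      intro hk
      obtain ⟨e, he, h'⟩ := htail 0 hk
      have := augmentedString_adj_iff.1 (hA e he)
      exact ⟨e, he, by omega, h'⟩
    | succ k ih =>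
      intro hk
      obtain ⟨e, he, hup, h1 | h1⟩ := ih (by omega)
      -- If `e'` pointed down, it would be the reverse of `e = (k, k + 1)` or share its head.
      · obtain ⟨e', he', h'⟩ := htail (k + 1) hk
        have hadj := augmentedString_adj_iff.1 (hA e' he')
        have hconf := hC e he e' he'
        simp only [EdgeConflict, Fin.ext_iff, ne_eq] at hconf
        exact ⟨e', he', by omega, h'⟩
      · exact ⟨e, he, hup, Or.inl h1⟩
  obtain ⟨e, he, hup, h'⟩ := key t (by omega)
  have := augmentedString_adj_iff.1 (hA e he)
  omega

lemma exists_conflictReduction_comp_fst_ne_zero {t : ℕ} {p : Fin (t + 2) → ℝ}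
    (hp : p ∈ realization (partitionComplex (threeOnes t))) :
    ∃ e, conflictReduction (fun e => (augmentedString t).Adj e.1 e.2) EdgeConflict
      (fun e => p e.1) e ≠ 0 := by
  obtain ⟨-, i, h1, h2⟩ := mem_partitionComplex_threeOnes.1 hp.2
  by_contra! h
  -- An edge whose conflicting edges all have weight `0` keeps its weight, which must then vanish as
  -- well.
  have hzero : ∀ e : Fin (t + 2) × Fin (t + 2), (augmentedString t).Adj e.1 e.2 →
      (∀ e' : Fin (t + 2) × Fin (t + 2), (augmentedString t).Adj e'.1 e'.2 → EdgeConflict e e' →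
        p e'.1 = 0) → p e.1 = 0 := by
    intro e he he'
    by_contra hne
    exact conflictReduction_pos (u := fun e : Fin (t + 2) × Fin (t + 2) => p e.1) he
      ((hp.1.1 e.1).lt_of_ne (Ne.symm hne)) he' (h e)
  have h1 : p i.castSucc = 0 := by simpa [mem_support] using h1
  have h2 : p i.succ = 0 := by simpa [mem_support] using h2
  have hstart : ∀ k : Fin (t + 2), k.val = i.val ∨ k.val = i.val + 1 → p k = 0 := by
    rintro k (hk | hk)
    · rwa [show k = i.castSucc from Fin.ext hk]
    · rwa [show k = i.succ from Fin.ext hk]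
  have hright : ∀ n, ∀ k : Fin (t + 2), k.val = i.val + n → p k = 0 := by
    intro n
    induction n using Nat.strong_induction_on with
    | _ n ih =>
      intro k hk
      by_cases hn : n < 2
      · exact hstart k (by omega)
      -- The edges in conflict with `k → k - 1` have tails `k - 1` and `k - 2`, where `p` is already
      -- known to vanish. On the left, `k → k + 1` plays the same role.
      · refine hzero (k, ⟨k.val - 1, by omega⟩) (augmentedString_adj_iff.2 ?_) fun e' he' hc => ?_
        · simp only
          omega
        · rw [augmentedString_adj_iff] at he'
          simp only [EdgeConflict, Fin.ext_iff, ne_eq] at hc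
          exact ih (e'.1.val - i.val) (by omega) e'.1 (by omega)
  have hleft : ∀ n, ∀ k : Fin (t + 2), k.val + n = i.val + 1 → p k = 0 := by
    intro n
    induction n using Nat.strong_induction_on with
    | _ n ih =>
      intro k hk
      by_cases hn : n < 2
      · exact hstart k (by omega)
      · refine hzero (k, ⟨k.val + 1, by omega⟩) (augmentedString_adj_iff.2 ?_) fun e' he' hc => ?_
        · exact ⟨Or.inl rfl, Nat.succ_pos _, by simp only; omega⟩
        · rw [augmentedString_adj_iff] at he'
          simp only [EdgeConflict, Fin.ext_iff, ne_eq] at hc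
          exact ih (i.val + 1 - e'.1.val) (by omega) e'.1 (by omega)
  have hsum := hp.1.2
  rw [Finset.sum_eq_zero fun k _ => ?_] at hsum
  · exact zero_ne_one hsum
  · rcases le_total i.val k.val with hk | hk
    · exact hright (k.val - i.val) k (by omega)
    · exact hleft (i.val + 1 - k.val) k (by omega)

/-- Every directed forest in `L'_t` has an edge `e`, such that no edge has the same tail as an edge in
conflict with `e`. One takes the last edge pointing upwards or the first one pointing downwards. -/
lemma exists_edge_forall_conflict {t : ℕ} {s : Finset (Fin (t + 2) × Fin (t + 2))}
    (hs : s ∈ forestComplex (augmentedString t)) :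
    ∃ e ∈ s, ∀ e', (augmentedString t).Adj e'.1 e'.2 → EdgeConflict e e' →
      ∀ e'' ∈ s, e''.1 ≠ e'.1 := by
  obtain ⟨⟨e₀, he₀⟩, hA, hC⟩ := (isConflictComplex_augmentedString t s).1 hs
  by_cases hup : ∃ e ∈ s, e.2.val = e.1.val + 1
  · obtain ⟨e, he, hmax⟩ := (s.filter fun e => e.2.val = e.1.val + 1).exists_max_image
      (fun e => e.1.val) (by simpa [Finset.Nonempty] using hup)
    obtain ⟨he, heup⟩ := Finset.mem_filter.1 he
    refine ⟨e, he, fun e' he' hc e'' hs'' heq => ?_⟩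
    -- With `e = (x, x + 1)`, the conflicting tails are `x + 1` and `x + 2`. An upward edge of `s`
    -- from there contradicts maximality; a downward one conflicts with `e`.
    have hm := hmax e''
    have ha'' := augmentedString_adj_iff.1 (hA e'' hs'')
    have hc'' := hC e he e'' hs''
    rw [augmentedString_adj_iff] at he'
    simp only [Finset.mem_filter, hs'', true_and] at hm
    simp only [EdgeConflict, Fin.ext_iff, ne_eq] at hc hc'' heq
    omega
  · have hdown : ∀ e ∈ s, e.1.val = e.2.val + 1 := by
      intro e he
      have := (hA e he).1
      push Not at hup
      have := hup e he
      omega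
    obtain ⟨e, he, hmin⟩ := s.exists_min_image (fun e => e.1.val) ⟨e₀, he₀⟩
    have hed := hdown e he
    refine ⟨e, he, fun e' he' hc e'' hs'' heq => ?_⟩
    -- The edges in conflict with a downward `e` have smaller tails than `e`.
    have hm := hmin e'' hs''
    rw [augmentedString_adj_iff] at he'
    simp only [EdgeConflict, Fin.ext_iff, ne_eq] at hc heq
    omega

lemma isHomotopyEquiv_realizationMap_fst (t : ℕ) :
    IsHomotopyEquiv (realizationMap (isSimplicialMap_fst t)) := by
  refine isHomotopyEquiv_of_conflictReduction_ne_zero (isConflictComplex_augmentedString t)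
    EdgeConflict.symm _ (fun p hp => exists_conflictReduction_comp_fst_ne_zero hp)
    fun w hw s => ?_
  -- At every time `s` the weight of `e` is at least `w e > 0`, while all edges in conflict with `e`
  -- have weight `0`.
  obtain ⟨e, he, hconf⟩ := exists_edge_forall_conflict hw.2
  have hzero : ∀ e' : Fin (t + 2) × Fin (t + 2), (∀ e'' ∈ support w, e''.1 ≠ e'.1) →
      ∑ b with b.1 = e'.1, w b = 0 := by
    refine fun e' he' => Finset.sum_eq_zero fun b hb => ?_
    by_contra hne
    exact he' b (mem_support.2 hne) (Finset.mem_filter.1 hb).2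
  refine ⟨e, conflictReduction_pos (((isConflictComplex_augmentedString t _).1 hw.2).2.1 e he)
    ?_ fun e' he' hc => ?_⟩
  · have hpos : 0 < w e := (hw.1.1 e).lt_of_ne (Ne.symm (mem_support.1 he))
    have hle : w e ≤ ∑ b with b.1 = e.1, w b :=
      Finset.single_le_sum (fun b _ => hw.1.1 b) (by simp)
    have := mul_le_mul_of_nonneg_left hle s.2.1
    linarith
  · have hw' : w e' = 0 := by
      by_contra hne
      exact hconf e' he' hc e' (mem_support.2 hne) rfl
    rw [hw', hzero e' (hconf e' he' hc)]
    simp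

end Combinatorics

end ForestComplex

theorem theorem2p2 (t : ℕ) :
    ∃ (hι : ForestComplex.IsSimplicialIso
          (ForestComplex.forestComplex (ForestComplex.doubleString t))
          (ForestComplex.forestComplex (ForestComplex.augmentedString t))
          (ForestComplex.edgeMap t))
      (hφ : ForestComplex.IsSimplicialMap
          (ForestComplex.forestComplex (ForestComplex.augmentedString t))
          (ForestComplex.partitionComplex (ForestComplex.threeOnes t))
          (fun e => e.1)),
      ForestComplex.IsHomotopyEquiv (ForestComplex.realizationMap hφ) ∧
      ForestComplex.IsHomotopyEquiv
        ((ForestComplex.realizationMap hφ).comp (ForestComplex.realizationMap hι.isSimplicialMap)) :=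
  ⟨ForestComplex.isSimplicialIso_edgeMap t, ForestComplex.isSimplicialMap_fst t,
    ForestComplex.isHomotopyEquiv_realizationMap_fst t,
    (ForestComplex.isHomotopyEquiv_realizationMap_fst t).comp
      (ForestComplex.isSimplicialIso_edgeMap t).isHomotopyEquiv⟩
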